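/- Let $k\ge 1$ be an integer and let $0<s_0<2^{-1+1/k}$. There exist constants $C,c\in(0,\infty)$, depending only on $k$ and $s_0$, such that the following holds. Let $(X,d)$ be any countable metric space equipped with a positive measure $\pi$ (that is, $0<\pi(x)<\infty$ for every point $x\in X$), and let $\ell^2(X,\pi)$ be the complex Hilbert space with norm $\|f\|^2=\sum_{x}|f(x)|^2\pi(x)$. For a bounded operator $T$ on $\ell^2(X,\pi)$ write $T(x,y)=(T\delta_y)(x)$ for its matrix entries, where $\delta_y$ is the function equal to $1$ at $y$ and $0$ elsewhere, so that $Tf(x)=\sum_y T(x,y)f(y)$. Let $M$ be any normal contraction on $\ell^2(X,\pi)$ such that $M(x,y)=0$ whenever $d(x,y)>1$, and whose spectrum is contained in $[a,1]$ for some $a\in[-1,1)$ with $1-a\le 2s_0$. Set $M_k=I-(I-M)^k$. Then for all $x,y\in X$ and all integers $n\ge 1$, $$|M_k^n(x,y)|\le C\left(\frac{\pi(y)}{\pi(x)}\right)^{1/2}\exp\left(-c\left(\frac{d(x,y)}{n^{1/(2k)}}\right)^{\frac{2k}{2k-1}}\right),$$ where $M_k^n(x,y)$ denotes the $(x,y)$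 matrix entry of the $n$-th power of $M_k$. -/

import Mathlib

open MeasureTheory

noncomputable section

/-- The point function `δ_y` (equal to `1` at `y` and `0` elsewhere) as an element of
`ℓ²(X, π)`, the complex Hilbert space with norm `‖f‖² = ∑ x, |f x|² π(x)`. -/
def pointFunction {X : Type*} [MeasurableSpace X] [MeasurableSingletonClass X]
    (π : Measure X) (hfin : ∀ x, π {x} ≠ ⊤) (y : X) : Lp ℂ 2 π :=
  indicatorConstLp 2 (measurableSet_singleton y) (hfin y) (1 : ℂ)

/-- The matrix entry `M(x, y) = (M δ_y)(x)` of a bounded operator `M` on `ℓ²(X, π)`. When all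
points have positive mass, values of elements of `Lp ℂ 2 π` at points are well defined, and
`(M f)(x) = ∑ y, M(x, y) f(y)`, see `hasSum_entry`. -/
def entry {X : Type*} [MeasurableSpace X] [MeasurableSingletonClass X]
    (π : Measure X) (hfin : ∀ x, π {x} ≠ ⊤) (M : Lp ℂ 2 π →L[ℂ] Lp ℂ 2 π) (x y : X) : ℂ :=
  (M (pointFunction π hfin y) : X → ℂ) x

/-- `M_k = I - (I - M)^k`. -/
def laplacianPowerOp {E : Type*} [NormedAddCommGroup E] [NormedSpace ℂ E]
    (M : E →L[ℂ] E) (k : ℕ) : E →L[ℂ] E :=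
  1 - (1 - M) ^ k

theorem inner_pointFunction {X : Type*} [MeasurableSpace X] [MeasurableSingletonClass X]
    (π : Measure X) (hfin : ∀ x, π {x} ≠ ⊤) (x : X) (f : Lp ℂ 2 π) :
    inner ℂ (pointFunction π hfin x) f = (π.real {x} : ℂ) * f x := by
  rw [pointFunction, L2.inner_indicatorConstLp_one, integral_singleton]
  simp

/-- The operator is given by its matrix: `(M f)(x) = ∑ y, M(x, y) f(y)`. -/
theorem hasSum_entry {X : Type*} [Countable X] [MeasurableSpace X]
    [MeasurableSingletonClass X] (π : Measure X) (hpos : ∀ x, π {x} ≠ 0)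
    (hfin : ∀ x, π {x} ≠ ⊤) (M : Lp ℂ 2 π →L[ℂ] Lp ℂ 2 π) (f : Lp ℂ 2 π) (x : X) :
    HasSum (fun y => entry π hfin M x y * f y) ((M f : X → ℂ) x) := by
  have hne : ∀ z, (π.real {z} : ℂ) ≠ 0 := fun z => by
    simpa [Measure.real, ENNReal.toReal_eq_zero_iff] using ⟨hpos z, hfin z⟩
  set g := ContinuousLinearMap.adjoint M (pointFunction π hfin x) with hg
  have h1 : ∀ h : Lp ℂ 2 π, (π.real {x} : ℂ) * (M h : X → ℂ) x = inner ℂ g h := fun h => by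
    rw [← inner_pointFunction π hfin, hg, ContinuousLinearMap.adjoint_inner_left]
  have h2 : ∀ y, (π.real {x} : ℂ) * entry π hfin M x y
      = (π.real {y} : ℂ) * (starRingEnd ℂ) (g y) := fun y => by
    rw [entry, h1, ← inner_conj_symm, inner_pointFunction]
    simp
  have h3 := hasSum_integral_iUnion (μ := π) (s := fun y : X => {y})
    (f := fun z => inner ℂ (g z) (f z)) (fun y => measurableSet_singleton y)
    (fun i j hij => by simpa using hij) (L2.integrable_inner g f).integrableOn
  rw [Set.iUnion_of_singleton, setIntegral_univ, ← L2.inner_def, ← h1 f] at h3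
  have h4 := h3.mul_left ((π.real {x} : ℂ)⁻¹)
  rw [inv_mul_cancel_left₀ (hne x)] at h4
  have h5 : (fun y => entry π hfin M x y * f y) = fun y =>
      ((π.real {x} : ℂ)⁻¹) * ∫ z in {y}, inner ℂ (g z) (f z) ∂π := by
    funext y
    rw [eq_inv_mul_iff_mul_eq₀ (hne x), ← mul_assoc, h2, integral_singleton]
    simp only [RCLike.inner_apply, Complex.real_smul]
    ring
  rw [h5]
  exact h4

end

open MeasureTheory

noncomputable section

/-! ### Matrix entries: the norm bound and finite propagation. -/

section Entries

/-! A polynomial of degree `j` in `M` has propagation at most `j`, and its norm is at most its sup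
over the spectrum, since `M` is normal. Write `M_k ^ n` as `∑ b j • T_j(q(M))`, where `q` maps `[1 -
2 * s₀, 1]` affinely onto `[-1, 1]`. Each `T_j(q(M))` is a contraction with zero entry at distance
greater than `j`, so only the tail `∑ ‖b j‖` over `j ≥ dist x y` contributes
(`norm_entry_aeval_comp_le`).

The `b j` are Fourier coefficients of `(1 - (s₀ * (1 - cos z)) ^ k) ^ n`. Integrating over `z = θ +
iη` instead of the real line gains `exp (-jη)`. The condition `(2 * s₀) ^ k < 2` bounds the base by
`exp (-cθ^(2k) + Kη^(2k))` on that line (`exists_norm_one_sub_pow_cos_le`). Integrating in `θ` and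
summing over `j` gives `n^(-1/(2k)) / η * exp (Knη^(2k) - dη)` up to a constant, with `d = dist x
y`; optimizing in `η` produces the exponent `2k/(2k-1)`. -/

theorem measureReal_singleton_pos {X : Type*} [MeasurableSpace X] (π : Measure X)
    (hpos : ∀ x, π {x} ≠ 0) (hfin : ∀ x, π {x} ≠ ⊤) (x : X) :
    0 < π.real {x} :=
  ENNReal.toReal_pos (hpos x) (hfin x)

variable {X : Type*} [MeasurableSpace X] [MeasurableSingletonClass X] (π : Measure X)

theorem entry_eq_inner (hpos : ∀ x, π {x} ≠ 0) (hfin : ∀ x, π {x} ≠ ⊤)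
    (T : Lp ℂ 2 π →L[ℂ] Lp ℂ 2 π) (x y : X) :
    entry π hfin T x y =
      (π.real {x} : ℂ)⁻¹ * inner ℂ (pointFunction π hfin x) (T (pointFunction π hfin y)) := by
  have hne : (π.real {x} : ℂ) ≠ 0 := by
    exact_mod_cast (measureReal_singleton_pos π hpos hfin x).ne'
  rw [inner_pointFunction, inv_mul_cancel_left₀ hne, entry]

theorem norm_pointFunction (hfin : ∀ x, π {x} ≠ ⊤) (x : X) :
    ‖pointFunction π hfin x‖ = √(π.real {x}) := by
  rw [pointFunction, norm_indicatorConstLp (by norm_num) (by norm_num), Real.sqrt_eq_rpow]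
  simp

theorem norm_entry_le (hpos : ∀ x, π {x} ≠ 0) (hfin : ∀ x, π {x} ≠ ⊤)
    (T : Lp ℂ 2 π →L[ℂ] Lp ℂ 2 π) (x y : X) :
    ‖entry π hfin T x y‖ ≤ ‖T‖ * (π.real {y} / π.real {x}) ^ (1 / 2 : ℝ) := by
  have hx := measureReal_singleton_pos π hpos hfin x
  rw [entry_eq_inner π hpos, norm_mul, norm_inv, Complex.norm_real, Real.norm_of_nonneg hx.le,
    ← Real.sqrt_eq_rpow, Real.sqrt_div measureReal_nonneg]
  have h1 := norm_inner_le_norm (𝕜 := ℂ) (pointFunction π hfin x) (T (pointFunction π hfin y))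
  have h2 := T.le_opNorm (pointFunction π hfin y)
  rw [norm_pointFunction] at h1 h2
  have hs : 0 < √(π.real {x}) := Real.sqrt_pos.2 hx
  calc _ ≤ (π.real {x})⁻¹ * (√(π.real {x}) * (‖T‖ * √(π.real {y}))) := by
        gcongr
        exact h1.trans (by gcongr)
    _ = (√(π.real {x}) * √(π.real {x}))⁻¹ * (√(π.real {x}) * (‖T‖ * √(π.real {y}))) := by
      rw [Real.mul_self_sqrt hx.le]
    _ = _ := by field_simp

theorem entry_sum_smul (hpos : ∀ x, π {x} ≠ 0) (hfin : ∀ x, π {x} ≠ ⊤) {ι : Type*} (s : Finset ι)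
    (b : ι → ℂ) (T : ι → Lp ℂ 2 π →L[ℂ] Lp ℂ 2 π) (x y : X) :
    entry π hfin (∑ i ∈ s, b i • T i) x y = ∑ i ∈ s, b i * entry π hfin (T i) x y := by
  simp only [entry_eq_inner π hpos, sum_apply, smul_apply,
    inner_sum, inner_smul_right, Finset.mul_sum]
  exact Finset.sum_congr rfl fun i _ => by ring

theorem entry_one_of_ne (hpos : ∀ x, π {x} ≠ 0) (hfin : ∀ x, π {x} ≠ ⊤) {x y : X} (h : x ≠ y) :
    entry π hfin 1 x y = 0 := by
  have h1 := indicatorConstLp_coeFn (p := 2) (hs := measurableSet_singleton y) (hμs := hfin y)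
    (c := (1 : ℂ))
  have h2 : (pointFunction π hfin y : X → ℂ) x = ({y} : Set X).indicator (fun _ => (1 : ℂ)) x := by
    by_contra hx
    exact hpos x (measure_mono_null (Set.singleton_subset_iff.2 hx) (ae_iff.1 h1))
  rw [entry, show (1 : Lp ℂ 2 π →L[ℂ] Lp ℂ 2 π) (pointFunction π hfin y) = pointFunction π hfin y from rfl, h2]
  simp [h]

theorem entry_mul_eq_zero [Countable X] (hpos : ∀ x, π {x} ≠ 0) (hfin : ∀ x, π {x} ≠ ⊤)
    {S T : Lp ℂ 2 π →L[ℂ] Lp ℂ 2 π} {x y : X}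
    (h : ∀ z, entry π hfin S x z = 0 ∨ entry π hfin T z y = 0) :
    entry π hfin (S * T) x y = 0 := by
  have h1 := hasSum_entry π hpos hfin S (T (pointFunction π hfin y)) x
  have h2 : (fun z => entry π hfin S x z * (T (pointFunction π hfin y) : X → ℂ) z) = 0 := by
    funext z
    exact mul_eq_zero.2 (h z)
  rw [h2] at h1
  exact h1.unique hasSum_zero

/-- Each factor moves a point by at most 1, so by the triangle inequality every intermediate point
kills one of the two factors. -/
theorem entry_pow_eq_zero {X : Type*} [Countable X] [MetricSpace X] [MeasurableSpace X]
    [MeasurableSingletonClass X] (π : Measure X) (hpos : ∀ x, π {x} ≠ 0)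
    (hfin : ∀ x, π {x} ≠ ⊤) {M : Lp ℂ 2 π →L[ℂ] Lp ℂ 2 π}
    (hM : ∀ x y, 1 < dist x y → entry π hfin M x y = 0) (m : ℕ) {x y : X} (h : m < dist x y) :
    entry π hfin (M ^ m) x y = 0 := by
  induction m generalizing x y with
  | zero => exact entry_one_of_ne π hpos hfin (dist_pos.1 (by simpa using h))
  | succ m ih =>
    rw [pow_succ]
    refine entry_mul_eq_zero π hpos hfin fun z => ?_
    by_cases hz : m < dist x z
    · exact Or.inl (ih hz)
    · refine Or.inr (hM z y ?_)
      have := dist_triangle x z y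
      push_cast at h
      linarith

theorem entry_aeval_eq_zero {X : Type*} [Countable X] [MetricSpace X] [MeasurableSpace X]
    [MeasurableSingletonClass X] (π : Measure X) (hpos : ∀ x, π {x} ≠ 0)
    (hfin : ∀ x, π {x} ≠ ⊤) {M : Lp ℂ 2 π →L[ℂ] Lp ℂ 2 π}
    (hM : ∀ x y, 1 < dist x y → entry π hfin M x y = 0) (p : Polynomial ℂ) {x y : X}
    (h : p.natDegree < dist x y) : entry π hfin (Polynomial.aeval M p) x y = 0 := by
  rw [Polynomial.aeval_eq_sum_range, entry_sum_smul π hpos]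
  refine Finset.sum_eq_zero fun i hi => ?_
  rw [entry_pow_eq_zero π hpos hfin hM i, mul_zero]
  refine lt_of_le_of_lt ?_ h
  exact_mod_cast Nat.lt_succ_iff.1 (Finset.mem_range.1 hi)

end Entries

/-! ### Functional calculus and Chebyshev polynomials. -/

theorem norm_aeval_le_of_isStarNormal {A : Type*} [CStarAlgebra A] {a : A} (ha : IsStarNormal a)
    (p : Polynomial ℂ) {c : ℝ} (hc : 0 ≤ c) (h : ∀ z ∈ spectrum ℂ a, ‖p.eval z‖ ≤ c) :
    ‖Polynomial.aeval a p‖ ≤ c := by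
  rw [← cfc_polynomial p a]
  exact norm_cfc_le hc h

-- The recurrence `X * T_j = (T_{j+1} + T_{j-1}) / 2` makes the span stable under multiplication by
-- `X`; the index `-1` is covered by `T_{-1} = T_1`.
open Polynomial in
theorem mem_span_range_chebyshev_T (p : ℂ[X]) :
    p ∈ Submodule.span ℂ (Set.range fun j : ℕ => Chebyshev.T ℂ j) := by
  set S := Submodule.span ℂ (Set.range fun j : ℕ => Chebyshev.T ℂ j) with hS
  have hT : ∀ n : ℤ, Chebyshev.T ℂ n ∈ S := fun n => by
    rw [← Chebyshev.T_natAbs]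
    exact Submodule.subset_span ⟨n.natAbs, rfl⟩
  have hX : ∀ q ∈ S, X * q ∈ S := fun q hq => by
    induction hq using Submodule.span_induction with
    | mem q hq =>
      obtain ⟨j, rfl⟩ := hq
      have h := Chebyshev.T_add_one ℂ (j : ℤ)
      have h2 : X * Chebyshev.T ℂ (j : ℤ) =
          (1 / 2 : ℂ) • (Chebyshev.T ℂ (j + 1 : ℤ) + Chebyshev.T ℂ (j - 1 : ℤ)) := by
        rw [h, sub_add_cancel, mul_assoc, two_mul, smul_add, ← add_smul]
        norm_num
      show X * Chebyshev.T ℂ (j : ℤ) ∈ S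
      rw [h2]
      exact S.smul_mem _ (S.add_mem (hT _) (hT _))
    | zero => simp
    | add a b _ _ ha hb => rw [mul_add]; exact S.add_mem ha hb
    | smul c a _ ha => rw [mul_smul_comm]; exact S.smul_mem c ha
  have hXn : ∀ n : ℕ, (X : ℂ[X]) ^ n ∈ S := fun n => by
    induction n with
    | zero => simpa using hT 0
    | succ n ih => rw [pow_succ']; exact hX _ ih
  rw [p.as_sum_range_C_mul_X_pow]
  refine S.sum_mem fun i _ => ?_
  rw [← smul_eq_C_mul]
  exact S.smul_mem _ (hXn i)

theorem norm_eval_chebyshev_T_le_one (j : ℤ) {u : ℝ} (hu : u ∈ Set.Icc (-1) 1) :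
    ‖(Polynomial.Chebyshev.T ℂ j).eval (u : ℂ)‖ ≤ 1 := by
  rw [← Polynomial.Chebyshev.complex_ofReal_eval_T, Complex.norm_real]
  exact Polynomial.Chebyshev.abs_eval_T_real_le_one j (abs_le.2 hu)

/-! ### Chebyshev coefficients as integrals along a shifted line. -/

open Complex in
theorem integral_exp_int_mul_add_mul_I (m : ℤ) (hm : m ≠ 0) (η : ℝ) :
    ∫ θ in -Real.pi..Real.pi, exp (I * m * (θ + η * I)) = 0 := by
  have hc : (I * m : ℂ) ≠ 0 := mul_ne_zero I_ne_zero (by exact_mod_cast hm)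
  have : ∀ θ : ℝ, exp (I * m * (θ + η * I)) = exp (I * m * θ) * exp (I * m * (η * I)) :=
    fun θ => by rw [← exp_add, mul_add]
  simp only [this]
  rw [intervalIntegral.integral_mul_const, integral_exp_mul_complex hc]
  have h2 : exp (I * m * (Real.pi : ℝ)) = exp (I * m * ((-Real.pi : ℝ) : ℂ)) := by
    rw [exp_eq_exp_iff_exists_int]
    exact ⟨m, by push_cast; ring⟩
  rw [h2, sub_self, zero_div, zero_mul]

-- Of the two exponentials in the cosine only the one of frequency `-j` can cancel `m`, which gives
-- half of `2π`; `m ≠ 0` excludes the other.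
open Complex in
theorem integral_cos_mul_exp (j m : ℕ) (hm : m ≠ 0) (η : ℝ) :
    ∫ θ in -Real.pi..Real.pi, cos (j * (θ + η * I)) * exp (I * m * (θ + η * I)) =
      if j = m then (Real.pi : ℂ) else 0 := by
  have h : ∀ θ : ℝ, cos (j * (θ + η * I)) * exp (I * m * (θ + η * I)) =
      (1 / 2) * exp (I * ((j + m : ℤ) : ℂ) * (θ + η * I)) +
        (1 / 2) * exp (I * ((m - j : ℤ) : ℂ) * (θ + η * I)) := fun θ => by
    rw [cos, div_mul_eq_mul_div, add_mul, ← exp_add, ← exp_add]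
    push_cast
    ring_nf
  have hi : ∀ l : ℤ, IntervalIntegrable
      (fun θ : ℝ => (1 / 2 : ℂ) * exp (I * l * (θ + η * I))) volume (-Real.pi) Real.pi := fun l => by
    apply Continuous.intervalIntegrable
    fun_prop
  simp only [h]
  rw [intervalIntegral.integral_add (hi _) (hi _), intervalIntegral.integral_const_mul,
    intervalIntegral.integral_const_mul, integral_exp_int_mul_add_mul_I _ (by omega)]
  split_ifs with hjm
  · subst hjm
    simp
    ring
  · rw [integral_exp_int_mul_add_mul_I _ (by omega)]
    simp

open Complex Polynomial in
theorem integral_eval_cos_mul_exp (b : ℕ →₀ ℂ) (m : ℕ) (hm : m ≠ 0) (η : ℝ) :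
    ∫ θ in -Real.pi..Real.pi, (b.sum fun j c => c • Chebyshev.T ℂ j).eval (cos (θ + η * I)) *
      exp (I * m * (θ + η * I)) = Real.pi * b m := by
  have h : ∀ θ : ℝ, (b.sum fun j c => c • Chebyshev.T ℂ j).eval (cos (θ + η * I)) *
      exp (I * m * (θ + η * I)) =
      ∑ j ∈ b.support, b j * (cos (j * (θ + η * I)) * exp (I * m * (θ + η * I))) := fun θ => by
    rw [Finsupp.sum, eval_finsetSum, Finset.sum_mul]
    refine Finset.sum_congr rfl fun j _ => ?_
    rw [eval_smul, Chebyshev.T_complex_cos, smul_eq_mul, mul_assoc, Int.cast_natCast]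
  simp only [h]
  rw [intervalIntegral.integral_finsetSum]
  · simp only [intervalIntegral.integral_const_mul, integral_cos_mul_exp _ m hm]
    simp [mul_comm]
  · intro j _
    apply Continuous.intervalIntegrable
    fun_prop

-- On the line of height `η` the kernel `exp (imz)` has modulus `exp (-mη)`: this is the source of
-- the decay in `m`.
open Complex Polynomial in
theorem norm_chebyshev_coeff_le (b : ℕ →₀ ℂ) (m : ℕ) (hm : m ≠ 0) (η : ℝ) {g : ℝ → ℝ}
    (hg : Continuous g)
    (h : ∀ θ ∈ Set.Icc (-Real.pi) Real.pi,
      ‖(b.sum fun j c => c • Chebyshev.T ℂ j).eval (cos (θ + η * I))‖ ≤ g θ) :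
    ‖b m‖ ≤ Real.exp (-(m * η)) / Real.pi * ∫ θ in -Real.pi..Real.pi, g θ := by
  have h1 := integral_eval_cos_mul_exp b m hm η
  have h2 : ‖(Real.pi : ℂ) * b m‖ ≤ ∫ θ in -Real.pi..Real.pi, g θ * Real.exp (-(m * η)) := by
    rw [← h1]
    refine intervalIntegral.norm_integral_le_of_norm_le (by linarith [Real.pi_pos])
      (Filter.Eventually.of_forall fun θ hθ => ?_) (Continuous.intervalIntegrable (by fun_prop) _ _)
    rw [norm_mul, norm_exp]
    have : (I * m * (θ + η * I)).re = -(m * η) := by simp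
    rw [this]
    gcongr
    exact h θ ⟨hθ.1.le, hθ.2⟩
  rw [norm_mul, Complex.norm_real, Real.norm_of_nonneg Real.pi_pos.le,
    intervalIntegral.integral_mul_const] at h2
  rw [div_mul_eq_mul_div, le_div_iff₀ Real.pi_pos]
  linarith

/-! ### Size of the symbol off the real axis. -/

theorem norm_pow_succ_sub_pow_succ_le {R : Type*} [NormedCommRing R] [NormOneClass R] {z w : R}
    {r : ℝ} (hz : ‖z‖ ≤ r) (hw : ‖w‖ ≤ r) (n : ℕ) :
    ‖z ^ (n + 1) - w ^ (n + 1)‖ ≤ (n + 1) * r ^ n * ‖z - w‖ := by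
  have hr : 0 ≤ r := (norm_nonneg z).trans hz
  induction n with
  | zero => simp
  | succ n ih =>
    have h : z ^ (n + 1 + 1) - w ^ (n + 1 + 1) =
        z * (z ^ (n + 1) - w ^ (n + 1)) + w ^ (n + 1) * (z - w) := by ring
    rw [h]
    calc _ ≤ ‖z‖ * ‖z ^ (n + 1) - w ^ (n + 1)‖ + ‖w‖ ^ (n + 1) * ‖z - w‖ :=
          (norm_add_le _ _).trans (add_le_add (norm_mul_le _ _)
            ((norm_mul_le _ _).trans (by gcongr; exact norm_pow_le _ _)))
      _ ≤ r * ((n + 1) * r ^ n * ‖z - w‖) + r ^ (n + 1) * ‖z - w‖ := by gcongr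
      _ = _ := by push_cast; ring

/-- A Young type inequality for the increment of a power. -/
theorem exists_mul_add_pow_mul_le (n : ℕ) {ε : ℝ} (hε : 0 < ε) :
    ∃ K : ℝ, 0 < K ∧ ∀ a h : ℝ, 0 ≤ a → 0 ≤ h →
      (n + 1) * (a + h) ^ n * h ≤ ε * a ^ (n + 1) + K * h ^ (n + 1) := by
  -- Threshold between the two regimes: for `h ≤ t * a` the left side is absorbed by `ε * a ^ (n +
  -- 1)`; otherwise `a < h / t` and everything is a multiple of `h ^ (n + 1)`.
  set t : ℝ := min 1 (ε / ((n + 1) * 2 ^ n)) with ht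
  have ht0 : 0 < t := by positivity
  refine ⟨(n + 1) * (1 / t + 1) ^ n, by positivity, fun a h ha hh => ?_⟩
  rcases le_or_gt h (t * a) with hta | hta
  · have h1 : h ≤ a := hta.trans (mul_le_of_le_one_left ha (min_le_left _ _))
    have h2 : t * ((n + 1) * 2 ^ n) ≤ ε := by
      rw [← le_div_iff₀ (by positivity)]
      exact min_le_right _ _
    calc (n + 1) * (a + h) ^ n * h ≤ (n + 1) * (a + a) ^ n * (t * a) := by gcongr
      _ = t * ((n + 1) * 2 ^ n) * a ^ (n + 1) := by rw [← two_mul, mul_pow]; ring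
      _ ≤ ε * a ^ (n + 1) := by gcongr
      _ ≤ _ := le_add_of_nonneg_right (by positivity)
  · have h1 : a ≤ 1 / t * h := by
      rw [one_div_mul_eq_div, le_div_iff₀ ht0]
      linarith
    calc (n + 1) * (a + h) ^ n * h ≤ (n + 1) * (1 / t * h + h) ^ n * h := by gcongr
      _ = (n + 1) * (1 / t + 1) ^ n * h ^ (n + 1) := by
        rw [← add_one_mul, mul_pow]; ring
      _ ≤ _ := le_add_of_nonneg_left (by positivity)

-- The real and imaginary parts of the difference are at most `cosh |η| - 1` and `sinh |η|`, whose
-- sum is `exp |η| - 1`.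
open Complex in
theorem norm_sin_add_mul_I_sub_sin_le (φ : ℝ) {η : ℝ} (hη : |η| ≤ 1) :
    ‖sin (φ + η * I) - (Real.sin φ : ℝ)‖ ≤ 2 * |η| := by
  have h : sin (φ + η * I) - (Real.sin φ : ℝ) =
      ((Real.sin φ * (Real.cosh |η| - 1) : ℝ) : ℂ) + ((Real.cos φ * Real.sinh η : ℝ) : ℂ) * I := by
    rw [sin_add_mul_I, Real.cosh_abs]
    push_cast
    ring
  rw [h]
  refine (norm_add_le _ _).trans ?_
  rw [norm_mul, norm_I, mul_one, Complex.norm_real, Complex.norm_real, norm_mul, norm_mul,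
    Real.norm_eq_abs, Real.norm_eq_abs, Real.norm_eq_abs, Real.norm_eq_abs, Real.abs_sinh]
  have h1 : |Real.cosh |η| - 1| = Real.cosh |η| - 1 :=
    abs_of_nonneg (sub_nonneg.2 (Real.one_le_cosh _))
  have h2 : 0 ≤ Real.sinh |η| := Real.sinh_nonneg_iff.2 (abs_nonneg _)
  have h3 : |Real.exp |η| - 1| ≤ 2 * |(|η|)| := Real.abs_exp_sub_one_le (by rwa [abs_abs])
  rw [abs_abs] at h3
  have h4 := le_abs_self (Real.exp |η| - 1)
  rw [← Real.cosh_add_sinh] at h3 h4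
  have h5 := mul_le_of_le_one_left (h1 ▸ abs_nonneg (Real.cosh |η| - 1)) (Real.abs_sin_le_one φ)
  have h6 := mul_le_of_le_one_left h2 (Real.abs_cos_le_one φ)
  rw [h1]
  linarith

-- On the real axis `B < 2` gives `|1 - B s^(2k)| ≤ 1 - δ s^(2k)` for `s = sin φ`. Moving off the
-- axis costs an increment which Young's inequality splits into half of this gain and a multiple of
-- `η^(2k)`; Jordan's inequality then replaces `s` by `φ`.
open Complex in
theorem exists_norm_one_sub_mul_sin_pow_le {k : ℕ} (hk : 1 ≤ k) {B : ℝ} (hB : 0 < B)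
    (hB2 : B < 2) :
    ∃ c K : ℝ, 0 < c ∧ 0 < K ∧ ∀ φ η : ℝ, |φ| ≤ Real.pi / 2 → |η| ≤ 1 →
      ‖1 - B * sin (φ + η * I) ^ (2 * k)‖ ≤ Real.exp (-(c * φ ^ (2 * k)) + K * η ^ (2 * k)) := by
  obtain ⟨m, hm⟩ : ∃ m, 2 * k = m + 1 := ⟨2 * k - 1, by omega⟩
  have heven : Even (m + 1) := hm ▸ even_two_mul k
  set δ := min B (2 - B) with hδ
  have hδ0 : 0 < δ := lt_min hB (by linarith)
  -- The parameter is `δ / (2B)`, so that after multiplication by `B` the error uses up only half of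
  -- `δ`.
  obtain ⟨K, hK, hyoung⟩ := exists_mul_add_pow_mul_le m (div_pos hδ0 (mul_pos two_pos hB))
  refine ⟨δ / 2 * (2 / Real.pi) ^ (m + 1), B * K * 2 ^ (m + 1),
    by have := Real.pi_pos; positivity, by positivity, fun φ η hφ hη => ?_⟩
  rw [hm]
  set s := Real.sin φ with hs
  set σ := sin (φ + η * I) with hσ
  have hd : ‖σ - (s : ℂ)‖ ≤ 2 * |η| := norm_sin_add_mul_I_sub_sin_le φ hη
  have hsn : ‖(s : ℂ)‖ = |s| := by rw [Complex.norm_real, Real.norm_eq_abs]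
  have hσn : ‖σ‖ ≤ |s| + 2 * |η| := by
    have := norm_add_le (σ - s) (s : ℂ)
    rw [sub_add_cancel, hsn] at this
    linarith
  have h1 : ‖σ ^ (m + 1) - (s : ℂ) ^ (m + 1)‖ ≤
      δ / (2 * B) * s ^ (m + 1) + K * (2 ^ (m + 1) * η ^ (m + 1)) := by
    refine (norm_pow_succ_sub_pow_succ_le hσn (by rw [hsn]; linarith [abs_nonneg η]) m).trans ?_
    have := hyoung |s| (2 * |η|) (abs_nonneg _) (by positivity)
    rw [heven.pow_abs, mul_pow, heven.pow_abs] at this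
    refine le_trans ?_ this
    gcongr
  have hs0 : 0 ≤ s ^ (m + 1) := heven.pow_nonneg s
  have hs1 : s ^ (m + 1) ≤ 1 := by
    rw [← heven.pow_abs]
    exact pow_le_one₀ (abs_nonneg _) (Real.abs_sin_le_one φ)
  have h2 : ‖(1 - B * s ^ (m + 1) : ℂ)‖ ≤ 1 - δ * s ^ (m + 1) := by
    have : (1 - B * s ^ (m + 1) : ℂ) = ((1 - B * s ^ (m + 1) : ℝ) : ℂ) := by push_cast; rfl
    rw [this, Complex.norm_real, Real.norm_eq_abs, abs_le]
    have e1 : δ ≤ B := min_le_left _ _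
    have e2 : δ ≤ 2 - B := min_le_right _ _
    constructor <;> nlinarith
  have h3 : (2 / Real.pi) ^ (m + 1) * φ ^ (m + 1) ≤ s ^ (m + 1) := by
    rw [← heven.pow_abs φ, ← heven.pow_abs s, ← mul_pow]
    exact pow_le_pow_left₀ (by have := Real.pi_pos; positivity) (Real.mul_abs_le_abs_sin hφ) _
  have h4 : (1 - B * σ ^ (m + 1) : ℂ) =
      (1 - B * s ^ (m + 1)) - B * (σ ^ (m + 1) - s ^ (m + 1)) := by ring
  calc ‖(1 - B * σ ^ (m + 1) : ℂ)‖
      ≤ (1 - δ * s ^ (m + 1)) +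
          B * (δ / (2 * B) * s ^ (m + 1) + K * (2 ^ (m + 1) * η ^ (m + 1))) := by
        rw [h4]
        refine (norm_sub_le _ _).trans (add_le_add h2 ?_)
        rw [norm_mul, Complex.norm_real, Real.norm_of_nonneg hB.le]
        gcongr
    _ = (-(δ / 2 * s ^ (m + 1)) + B * K * 2 ^ (m + 1) * η ^ (m + 1)) + 1 := by
        field_simp
        ring
    _ ≤ (-(δ / 2 * (2 / Real.pi) ^ (m + 1) * φ ^ (m + 1)) +
          B * K * 2 ^ (m + 1) * η ^ (m + 1)) + 1 := by
        rw [mul_assoc (δ / 2)]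
        gcongr
    _ ≤ _ := Real.add_one_le_exp _

-- Since `1 - cos z = 2 sin² (z/2)`, this is the sine estimate with `B = (2 * s₀) ^ k`.
open Complex in
theorem exists_norm_one_sub_pow_cos_le {k : ℕ} (hk : 1 ≤ k) {s₀ : ℝ} (hs₀ : 0 < s₀)
    (h2 : (2 * s₀) ^ k < 2) :
    ∃ c K : ℝ, 0 < c ∧ 0 < K ∧ ∀ θ η : ℝ, |θ| ≤ Real.pi → |η| ≤ 1 →
      ‖1 - (s₀ * (1 - cos (θ + η * I))) ^ k‖ ≤
        Real.exp (-(c * θ ^ (2 * k)) + K * η ^ (2 * k)) := by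
  obtain ⟨c, K, hc, hK, h⟩ :=
    exists_norm_one_sub_mul_sin_pow_le hk (pow_pos (mul_pos two_pos hs₀) k) h2
  refine ⟨c / 2 ^ (2 * k), K / 2 ^ (2 * k), by positivity, by positivity, fun θ η hθ hη => ?_⟩
  have h3 := h (θ / 2) (η / 2) (by rw [abs_div, abs_two]; linarith)
    (by rw [abs_div, abs_two]; linarith [abs_nonneg η])
  have h4 : (1 - cos (θ + η * I)) = 2 * sin ((θ / 2 : ℝ) + (η / 2 : ℝ) * I) ^ 2 := by
    have : (θ + η * I : ℂ) = 2 * ((θ / 2 : ℝ) + (η / 2 : ℝ) * I) := by push_cast; ring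
    rw [this, cos_two_mul, cos_sq']
    ring
  rw [h4, ← mul_assoc, mul_pow, ← pow_mul]
  have h5 : -(c / 2 ^ (2 * k) * θ ^ (2 * k)) + K / 2 ^ (2 * k) * η ^ (2 * k) =
      -(c * (θ / 2) ^ (2 * k)) + K * (η / 2) ^ (2 * k) := by
    rw [div_pow, div_pow]
    ring
  have h6 : (s₀ * 2 : ℂ) ^ k = (((2 * s₀) ^ k : ℝ) : ℂ) := by
    push_cast
    ring
  rw [h5, h6]
  exact h3

/-! ### The integral in `θ` and the sum over the tail. -/

theorem exists_integral_exp_neg_mul_pow_le {k : ℕ} (hk : 1 ≤ k) {c : ℝ} (hc : 0 < c) :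
    ∃ A : ℝ, 0 < A ∧ ∀ n : ℝ, 0 < n →
      ∫ θ in -Real.pi..Real.pi, Real.exp (-(n * (c * θ ^ (2 * k)))) ≤
        A * n ^ (-(1 / (2 * (k : ℝ)))) := by
  have hk0 : (0 : ℝ) < 2 * k := by positivity
  have hG : 0 < Real.Gamma (1 / (2 * k) + 1) := Real.Gamma_pos_of_pos (by positivity)
  refine ⟨2 * (c ^ (-1 / (2 * (k : ℝ))) * Real.Gamma (1 / (2 * k) + 1)),
    by positivity, fun n hn => ?_⟩
  have hnc : 0 < n * c := mul_pos hn hc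
  set f : ℝ → ℝ := fun θ => Real.exp (-(n * (c * θ ^ (2 * k)))) with hf
  have hfi : ∀ a b, IntervalIntegrable f volume a b := fun a b =>
    Continuous.intervalIntegrable (by fun_prop) _ _
  have heq : Set.EqOn f (fun x => Real.exp (-(n * c) * x ^ (2 * (k : ℝ)))) (Set.Ioi 0) :=
    fun x _ => by
      have : x ^ (2 * (k : ℝ)) = x ^ (2 * k) := by rw [← Real.rpow_natCast]; push_cast; rfl
      simp only [hf, this]
      ring_nf
  have hint : IntegrableOn f (Set.Ioi 0) := by
    refine IntegrableOn.congr_fun ?_ heq.symm measurableSet_Ioi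
    have := integrableOn_rpow_mul_exp_neg_mul_rpow (s := 0) (by norm_num) hk0 hnc
    simpa using this
  have h1 : ∫ θ in (0 : ℝ)..Real.pi, f θ ≤
      (n * c) ^ (-1 / (2 * (k : ℝ))) * Real.Gamma (1 / (2 * k) + 1) := by
    rw [← integral_exp_neg_mul_rpow hk0 hnc, ← setIntegral_congr_fun measurableSet_Ioi heq,
      intervalIntegral.integral_of_le Real.pi_pos.le]
    exact setIntegral_mono_set hint (Filter.Eventually.of_forall fun x => (Real.exp_pos _).le)
      Set.Ioc_subset_Ioi_self.eventuallyLE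
  have h2 : ∫ θ in -Real.pi..0, f θ = ∫ θ in (0 : ℝ)..Real.pi, f θ := by
    have := intervalIntegral.integral_comp_neg (a := 0) (b := Real.pi) f
    rw [neg_zero] at this
    rw [← this]
    simp only [hf, (even_two_mul k).neg_pow]
  rw [← intervalIntegral.integral_add_adjacent_intervals (hfi _ 0) (hfi 0 _), h2]
  rw [Real.mul_rpow hn.le hc.le] at h1
  rw [neg_div] at h1 ⊢
  linarith

theorem sum_exp_neg_mul_le (s : Finset ℕ) {d η : ℝ} (hη : 0 < η) (hη1 : η ≤ 1)
    (hs : ∀ j ∈ s, d ≤ j) :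
    ∑ j ∈ s, Real.exp (-(j * η)) ≤ Real.exp (-(d * η)) * (2 / η) := by
  set r := Real.exp (-η) with hr
  have hr0 : 0 < r := Real.exp_pos _
  -- From `exp η ≥ 1 + η` one gets `1 - r ≥ η / (1 + η)`, which is at least `η / 2` because `η ≤ 1`.
  have hr1 : 1 - r ≥ η / 2 := by
    have h1 : r * Real.exp η = 1 := by rw [hr, ← Real.exp_add]; simp
    nlinarith [Real.add_one_le_exp η]
  have hpow : ∀ j : ℕ, Real.exp (-(j * η)) = r ^ j := fun j => by
    rw [hr, ← Real.exp_nat_mul]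
    ring_nf
  obtain ⟨N, hN⟩ := s.bddAbove
  have hsub : s ⊆ Finset.Ico ⌈d⌉₊ (N + 1) := fun j hj =>
    Finset.mem_Ico.2 ⟨Nat.ceil_le.2 (hs j hj), Nat.lt_succ_of_le (hN hj)⟩
  calc ∑ j ∈ s, Real.exp (-(j * η)) = ∑ j ∈ s, r ^ j := Finset.sum_congr rfl fun j _ => hpow j
    _ ≤ ∑ j ∈ Finset.Ico ⌈d⌉₊ (N + 1), r ^ j :=
        Finset.sum_le_sum_of_subset_of_nonneg hsub fun _ _ _ => by positivity
    _ ≤ r ^ ⌈d⌉₊ / (1 - r) := geom_sum_Ico_le_of_lt_one hr0.le (by linarith)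
    _ ≤ r ^ ⌈d⌉₊ / (η / 2) := by gcongr
    _ = Real.exp (-(⌈d⌉₊ * η)) * (2 / η) := by rw [hpow]; field_simp
    _ ≤ _ := by gcongr; exact Nat.le_ceil d

/-! ### Bounds for the powers of `M_k`. -/

open Polynomial in
theorem aeval_eq_laplacianPowerOp_pow {E : Type*} [NormedAddCommGroup E] [NormedSpace ℂ E]
    (M : E →L[ℂ] E) (k n : ℕ) :
    aeval M ((1 - (1 - X : ℂ[X]) ^ k) ^ n) = laplacianPowerOp M k ^ n := by
  simp [laplacianPowerOp]

theorem pow_lt_two_of_lt_two_rpow {k : ℕ} (hk : 1 ≤ k) {s₀ : ℝ} (hs₀ : 0 < s₀)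
    (h : s₀ < (2 : ℝ) ^ (-1 + 1 / (k : ℝ))) : (2 * s₀) ^ k < 2 := by
  have h1 : 2 * s₀ < (2 : ℝ) ^ (1 / (k : ℝ)) := by
    rw [Real.rpow_add two_pos, Real.rpow_neg_one] at h
    linarith
  calc (2 * s₀) ^ k < ((2 : ℝ) ^ (1 / (k : ℝ))) ^ k :=
        pow_lt_pow_left₀ h1 (by positivity) (by omega)
    _ = 2 := by
      rw [one_div, Real.rpow_inv_natCast_pow two_pos.le (by omega)]

/-- On the spectrum `(1 - r) ^ k` lies in `[0, 2]`, so `1 - (1 - r) ^ k` lies in `[-1, 1]`. -/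
theorem norm_laplacianPowerOp_pow_le_one {E : Type*} [NormedAddCommGroup E]
    [InnerProductSpace ℂ E] [CompleteSpace E] {M : E →L[ℂ] E} (hM : IsStarNormal M) {a s₀ : ℝ}
    (ha : 1 - a ≤ 2 * s₀) (hspec : spectrum ℂ M ⊆ Complex.ofReal '' Set.Icc a 1) {k : ℕ}
    (h2 : (2 * s₀) ^ k < 2) (n : ℕ) : ‖laplacianPowerOp M k ^ n‖ ≤ 1 := by
  rw [← aeval_eq_laplacianPowerOp_pow]
  refine norm_aeval_le_of_isStarNormal hM _ zero_le_one fun z hz => ?_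
  obtain ⟨r, hr, rfl⟩ := hspec hz
  have h0 : (0 : ℝ) ≤ (1 - r) ^ k := pow_nonneg (by linarith [hr.2]) k
  have h1 : (1 - r) ^ k ≤ (2 * s₀) ^ k :=
    pow_le_pow_left₀ (by linarith [hr.2]) (by linarith [hr.1]) k
  have h3 : ((1 - (1 - Polynomial.X : Polynomial ℂ) ^ k) ^ n).eval (r : ℂ) =
      (((1 - (1 - r) ^ k) ^ n : ℝ) : ℂ) := by simp
  rw [h3, Complex.norm_real, norm_pow]
  refine pow_le_one₀ (norm_nonneg _) ?_
  rw [Real.norm_eq_abs, abs_le]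
  constructor <;> linarith

/-- Off-diagonal bound for a polynomial of `M` from the Chebyshev coefficients of the polynomial
transported from `[1 - 2 * s₀, 1]` to `[-1, 1]`. -/
theorem norm_entry_aeval_comp_le {X : Type*} [Countable X] [MetricSpace X] [MeasurableSpace X]
    [MeasurableSingletonClass X] (π : Measure X) (hpos : ∀ x, π {x} ≠ 0)
    (hfin : ∀ x, π {x} ≠ ⊤) {M : Lp ℂ 2 π →L[ℂ] Lp ℂ 2 π} (hMn : IsStarNormal M)
    (hM : ∀ x y, 1 < dist x y → entry π hfin M x y = 0) {a s₀ : ℝ} (hs₀ : 0 < s₀)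
    (ha : 1 - a ≤ 2 * s₀) (hspec : spectrum ℂ M ⊆ Complex.ofReal '' Set.Icc a 1)
    (b : ℕ →₀ ℂ) (x y : X) :
    ‖entry π hfin (Polynomial.aeval M ((b.sum fun j c => c • Polynomial.Chebyshev.T ℂ j).comp
      (Polynomial.C (s₀ : ℂ)⁻¹ * (Polynomial.X - Polynomial.C (1 - s₀ : ℂ))))) x y‖ ≤
      (∑ j ∈ b.support with dist x y ≤ (j : ℕ), ‖b j‖) *
        (π.real {y} / π.real {x}) ^ (1 / 2 : ℝ) := by
  set q : Polynomial ℂ := Polynomial.C (s₀ : ℂ)⁻¹ * (Polynomial.X - Polynomial.C (1 - s₀ : ℂ))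
    with hq
  have hs : (s₀ : ℂ) ≠ 0 := by exact_mod_cast hs₀.ne'
  have hqdeg : q.natDegree = 1 := by
    rw [hq, Polynomial.natDegree_C_mul (inv_ne_zero hs), Polynomial.natDegree_X_sub_C]
  have hqeval : ∀ r ∈ Set.Icc a 1, ∃ u ∈ Set.Icc (-1 : ℝ) 1, q.eval (r : ℂ) = u := fun r hr => by
    refine ⟨s₀⁻¹ * (r - (1 - s₀)), ⟨?_, ?_⟩, by simp [hq]⟩
    · rw [← div_eq_inv_mul, le_div_iff₀ hs₀]
      linarith [hr.1]
    · rw [← div_eq_inv_mul, div_le_iff₀ hs₀]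
      linarith [hr.2]
  have hexp : Polynomial.aeval M ((b.sum fun j c => c • Polynomial.Chebyshev.T ℂ j).comp q) =
      ∑ j ∈ b.support, b j • Polynomial.aeval M ((Polynomial.Chebyshev.T ℂ j).comp q) := by
    simp only [Finsupp.sum, Polynomial.aeval_comp, map_sum, map_smul]
  rw [hexp, entry_sum_smul π hpos, Finset.sum_filter, Finset.sum_mul]
  refine norm_sum_le_of_le _ fun j _ => ?_
  split_ifs with hj
  · rw [norm_mul]
    refine mul_le_mul_of_nonneg_left ((norm_entry_le π hpos hfin _ x y).trans ?_) (norm_nonneg _)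
    refine mul_le_of_le_one_left (by positivity)
      (norm_aeval_le_of_isStarNormal hMn _ zero_le_one fun z hz => ?_)
    obtain ⟨r, hr, rfl⟩ := hspec hz
    obtain ⟨u, hu, hqu⟩ := hqeval r hr
    rw [Polynomial.eval_comp, hqu]
    exact norm_eval_chebyshev_T_le_one j hu
  · rw [entry_aeval_eq_zero π hpos hfin hM, mul_zero, norm_zero, zero_mul]
    rw [Polynomial.natDegree_comp, hqdeg, mul_one, Polynomial.Chebyshev.natDegree_T,
      Int.natAbs_natCast]
    exact not_le.1 hj

/-- Decay of `M_k ^ n` off the diagonal with a free parameter `η`. -/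
theorem exists_norm_entry_laplacianPowerOp_pow_le {k : ℕ} (hk : 1 ≤ k) {s₀ : ℝ} (hs₀ : 0 < s₀)
    (h2 : (2 * s₀) ^ k < 2) :
    ∃ A K : ℝ, 0 < A ∧ 0 < K ∧
      ∀ (X : Type*) [Countable X] [MetricSpace X] [MeasurableSpace X]
        [MeasurableSingletonClass X] (π : Measure X)
        (_hpos : ∀ x, π {x} ≠ 0) (hfin : ∀ x, π {x} ≠ ⊤)
        (M : Lp ℂ 2 π →L[ℂ] Lp ℂ 2 π) (a : ℝ),
        IsStarNormal M →
        (∀ x y, 1 < dist x y → entry π hfin M x y = 0) →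
        1 - a ≤ 2 * s₀ →
        spectrum ℂ M ⊆ Complex.ofReal '' Set.Icc a 1 →
        ∀ (x y : X) (n : ℕ) (η : ℝ), 1 ≤ n → 0 < dist x y → 0 < η → η ≤ 1 →
          ‖entry π hfin (laplacianPowerOp M k ^ n) x y‖ ≤
            A * (n : ℝ) ^ (-(1 / (2 * (k : ℝ)))) / η *
              Real.exp (K * (n * η ^ (2 * k)) - dist x y * η) *
              (π.real {y} / π.real {x}) ^ (1 / 2 : ℝ) := by
  obtain ⟨c, K, hc, hK, hsymb⟩ := exists_norm_one_sub_pow_cos_le hk hs₀ h2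
  obtain ⟨A, hA, hint⟩ := exists_integral_exp_neg_mul_pow_le hk hc
  have hpi := Real.pi_pos
  refine ⟨A / Real.pi * 2, K, by positivity, hK, ?_⟩
  intro X _ _ _ _ π hpos hfin M a hMn hM ha hspec x y n η hn hd hη hη1
  have hs : (s₀ : ℂ) ≠ 0 := by exact_mod_cast hs₀.ne'
  have hn0 : (0 : ℝ) < n := by exact_mod_cast hn
  -- The polynomial defining `M_k ^ n`, in the variable `u` with `r = 1 - s₀ * (1 - u)`.
  set G : Polynomial ℂ := (1 - (Polynomial.C (s₀ : ℂ) * (1 - Polynomial.X)) ^ k) ^ n with hG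
  obtain ⟨b, hb⟩ := Finsupp.mem_span_range_iff_exists_finsupp.1 (mem_span_range_chebyshev_T G)
  have hcomp : G.comp (Polynomial.C (s₀ : ℂ)⁻¹ * (Polynomial.X - Polynomial.C (1 - s₀ : ℂ))) =
      (1 - (1 - Polynomial.X) ^ k) ^ n := by
    have : Polynomial.C (s₀ : ℂ) * (1 - Polynomial.C (s₀ : ℂ)⁻¹ *
        (Polynomial.X - Polynomial.C (1 - s₀ : ℂ))) = 1 - Polynomial.X := by
      rw [mul_sub, ← mul_assoc, ← Polynomial.C_mul, mul_inv_cancel₀ hs,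
        Polynomial.C_sub, Polynomial.C_1]
      ring
    simp only [hG, Polynomial.pow_comp, Polynomial.sub_comp, Polynomial.mul_comp,
      Polynomial.one_comp, Polynomial.C_comp, Polynomial.X_comp, this]
  have hentry := norm_entry_aeval_comp_le π hpos hfin hMn hM hs₀ ha hspec b x y
  rw [hb, hcomp, aeval_eq_laplacianPowerOp_pow] at hentry
  set E := Real.exp (K * (n * η ^ (2 * k))) with hE
  have hcoeff : ∀ j : ℕ, dist x y ≤ j →
      ‖b j‖ ≤ A / Real.pi * (n : ℝ) ^ (-(1 / (2 * (k : ℝ)))) * E * Real.exp (-(j * η)) := by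
    intro j hj
    -- The coefficient formula fails for `j = 0`; positive distance keeps that index out of the
    -- tail.
    have hj0 : j ≠ 0 := by
      rintro rfl
      exact absurd hd (not_lt.2 (by simpa using hj))
    have h1 := norm_chebyshev_coeff_le b j hj0 η
      (g := fun θ => Real.exp (-(n * (c * θ ^ (2 * k)))) * E) (by fun_prop) fun θ hθ => by
        have h3 := hsymb θ η (abs_le.2 hθ) (by rwa [abs_of_pos hη])
        rw [hb]
        simp only [hG, Polynomial.eval_pow, Polynomial.eval_sub, Polynomial.eval_one,
          Polynomial.eval_mul, Polynomial.eval_C, Polynomial.eval_X, norm_pow]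
        refine (pow_le_pow_left₀ (norm_nonneg _) h3 n).trans_eq ?_
        rw [hE, ← Real.exp_nat_mul, ← Real.exp_add]
        ring_nf
    rw [intervalIntegral.integral_mul_const] at h1
    refine h1.trans ?_
    calc _ ≤ Real.exp (-(j * η)) / Real.pi * (A * (n : ℝ) ^ (-(1 / (2 * (k : ℝ)))) * E) := by
          gcongr
          exact hint n hn0
      _ = _ := by ring
  have hsum : ∑ j ∈ b.support with dist x y ≤ (j : ℕ), ‖b j‖ ≤
      A / Real.pi * (n : ℝ) ^ (-(1 / (2 * (k : ℝ)))) * E *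
        (Real.exp (-(dist x y * η)) * (2 / η)) := by
    refine (Finset.sum_le_sum fun j hj => hcoeff j (Finset.mem_filter.1 hj).2).trans ?_
    rw [← Finset.mul_sum]
    gcongr
    exact sum_exp_neg_mul_le _ hη hη1 fun j hj => (Finset.mem_filter.1 hj).2
  refine hentry.trans (mul_le_mul_of_nonneg_right (hsum.trans_eq ?_) (by positivity))
  rw [sub_eq_add_neg, Real.exp_add]
  ring

theorem entry_laplacianPowerOp_pow_eq_zero {X : Type*} [Countable X] [MetricSpace X]
    [MeasurableSpace X] [MeasurableSingletonClass X] (π : Measure X) (hpos : ∀ x, π {x} ≠ 0)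
    (hfin : ∀ x, π {x} ≠ ⊤) {M : Lp ℂ 2 π →L[ℂ] Lp ℂ 2 π}
    (hM : ∀ x y, 1 < dist x y → entry π hfin M x y = 0) (k n : ℕ) {x y : X}
    (h : (k * n : ℝ) < dist x y) : entry π hfin (laplacianPowerOp M k ^ n) x y = 0 := by
  rw [← aeval_eq_laplacianPowerOp_pow]
  refine entry_aeval_eq_zero π hpos hfin hM _ (lt_of_le_of_lt ?_ h)
  have : ((1 - (1 - Polynomial.X : Polynomial ℂ) ^ k) ^ n).natDegree ≤ k * n := by
    compute_degree
    rw [mul_comm]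
  exact_mod_cast this

/-! ### Choice of `η` and the three ranges of the distance. -/

theorem mainTheorem7 (k : ℕ) (hk : 1 ≤ k) (s₀ : ℝ) (hs₀ : 0 < s₀)
    (hs₀k : s₀ < (2 : ℝ) ^ (-1 + 1 / (k : ℝ))) :
    ∃ C c : ℝ, 0 < C ∧ 0 < c ∧
      ∀ (X : Type*) [Countable X] [MetricSpace X] [MeasurableSpace X]
        [MeasurableSingletonClass X] (π : Measure X)
        (_hpos : ∀ x, π {x} ≠ 0) (hfin : ∀ x, π {x} ≠ ⊤)
        (M : Lp ℂ 2 π →L[ℂ] Lp ℂ 2 π) (a : ℝ),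
        IsStarNormal M → ‖M‖ ≤ 1 →
        (∀ x y, 1 < dist x y → entry π hfin M x y = 0) →
        -1 ≤ a → a < 1 → 1 - a ≤ 2 * s₀ →
        spectrum ℂ M ⊆ Complex.ofReal '' Set.Icc a 1 →
        ∀ (x y : X) (n : ℕ), 1 ≤ n →
          ‖entry π hfin (laplacianPowerOp M k ^ n) x y‖ ≤
            C * (π.real {y} / π.real {x}) ^ (1 / 2 : ℝ) *
              Real.exp (-(c * (dist x y / (n : ℝ) ^ (1 / (2 * (k : ℝ)))) ^
                (2 * (k : ℝ) / (2 * (k : ℝ) - 1)))) := by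
  have h2 := pow_lt_two_of_lt_two_rpow hk hs₀ hs₀k
  obtain ⟨A, K, hA, hK, hmain⟩ := exists_norm_entry_laplacianPowerOp_pow_le hk hs₀ h2
  have hk1 : (1 : ℝ) ≤ k := by exact_mod_cast hk
  have hk0 : (0 : ℝ) < k := by linarith
  -- The bound `ε ≤ 1 / k` will give `η ≤ 1`; `ε ≤ 1 / (2K)` gives `K ε^(2k) ≤ K ε² ≤ ε / 2`, so
  -- half of the decay survives the growth term.
  set ε : ℝ := min (1 / k) (1 / (2 * K)) with hε
  have hε0 : 0 < ε := by positivity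
  have hεk : ε * k ≤ 1 := by
    rw [← le_div_iff₀ hk0]
    exact min_le_left _ _
  have hε1 : ε ≤ 1 := by nlinarith
  have hεK : K * ε ^ (2 * k) ≤ ε / 2 := by
    have h3 : ε * (2 * K) ≤ 1 := by
      rw [← le_div_iff₀ (by positivity)]
      exact min_le_right _ _
    have h4 : ε ^ (2 * k) ≤ ε ^ 2 := pow_le_pow_of_le_one hε0.le hε1 (by omega)
    nlinarith
  refine ⟨Real.exp (ε / 2) + A / ε, ε / 2, by positivity, by positivity, ?_⟩
  intro X _ _ _ _ π hpos hfin M a hMn _ hM _ _ ha hspec x y n hn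
  have hn0 : (0 : ℝ) < n := by exact_mod_cast hn
  set α : ℝ := 1 / (2 * (k : ℝ) - 1) with hα
  have h2k : 0 < 2 * (k : ℝ) - 1 := by linarith
  have hα0 : 0 < α := by positivity
  have hα1 : α ≤ 1 := by
    rw [hα, div_le_one h2k]
    linarith
  have hq : 2 * (k : ℝ) / (2 * (k : ℝ) - 1) = 1 + α := by
    rw [hα]
    field_simp
    ring
  have hαq : α * ((2 * k : ℕ) : ℝ) = 1 + α := by
    rw [← hq, hα]
    push_cast
    ring
  set N : ℝ := (n : ℝ) ^ (1 / (2 * (k : ℝ))) with hN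
  have hN0 : 0 < N := by positivity
  have hNn : N ^ (2 * k) = n := by
    rw [hN, ← Real.rpow_natCast, ← Real.rpow_mul hn0.le]
    push_cast
    rw [one_div_mul_cancel (by positivity), Real.rpow_one]
  have hNneg : (n : ℝ) ^ (-(1 / (2 * (k : ℝ)))) = N⁻¹ := Real.rpow_neg hn0.le _
  set P := (π.real {y} / π.real {x}) ^ (1 / 2 : ℝ) with hP
  have hP0 : 0 ≤ P := by positivity
  set R := dist x y / N with hR
  have hR0 : 0 ≤ R := by positivity
  have hdR : dist x y = R * N := by rw [hR, div_mul_cancel₀ _ hN0.ne']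
  rw [hq]
  rcases lt_or_ge R 1 with hR1 | hR1
  -- Near the diagonal the exponential is bounded below, and contractivity of `M_k ^ n` suffices.
  · have h3 : ‖entry π hfin (laplacianPowerOp M k ^ n) x y‖ ≤ P :=
      (norm_entry_le π hpos hfin _ x y).trans (mul_le_of_le_one_left hP0
        (norm_laplacianPowerOp_pow_le_one hMn ha hspec h2 n))
    have h4 : R ^ (1 + α) ≤ 1 := Real.rpow_le_one hR0 hR1.le (by positivity)
    have h5 : 1 ≤ Real.exp (ε / 2) * Real.exp (-(ε / 2 * R ^ (1 + α))) := by
      rw [← Real.exp_add, Real.one_le_exp_iff]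
      nlinarith
    calc _ ≤ P := h3
      _ ≤ P * (Real.exp (ε / 2) * Real.exp (-(ε / 2 * R ^ (1 + α)))) := le_mul_of_one_le_right hP0 h5
      _ = Real.exp (ε / 2) * P * Real.exp (-(ε / 2 * R ^ (1 + α))) := by ring
      _ ≤ _ := by gcongr; exact le_add_of_nonneg_right (by positivity)
  -- `M_k ^ n` has degree at most `k * n` in `M`, so beyond this distance the entry vanishes.
  rcases lt_or_ge ((k : ℝ) * n) (dist x y) with hkn | hkn
  · rw [entry_laplacianPowerOp_pow_eq_zero π hpos hfin hM k n hkn, norm_zero]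
    positivity
  have hRα1 : 1 ≤ R ^ α := Real.one_le_rpow hR1 hα0.le
  -- This is where `dist x y ≤ k * n` enters: it keeps the `η` chosen below at most 1.
  have hRk : R ^ α ≤ k * N := by
    have h3 : R ≤ k * N ^ (2 * (k : ℝ) - 1) := by
      rw [Real.rpow_sub_one hN0.ne']
      have h5 : N ^ (2 * (k : ℝ)) = n := by
        rw [← hNn, ← Real.rpow_natCast]
        push_cast
        rfl
      rw [h5, ← mul_div_assoc, hR]
      gcongr
    calc R ^ α ≤ (k * N ^ (2 * (k : ℝ) - 1)) ^ α := Real.rpow_le_rpow hR0 h3 hα0.le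
      _ = k ^ α * N := by
        rw [Real.mul_rpow hk0.le (by positivity), ← Real.rpow_mul hN0.le, hα,
          mul_one_div_cancel h2k.ne', Real.rpow_one]
      _ ≤ k ^ (1 : ℝ) * N := by gcongr
      _ = k * N := by rw [Real.rpow_one]
  -- Up to `ε`, the scale at which `n η^(2k)` and `dist x y * η` balance; both are then multiples of
  -- `R ^ (1 + α)`.
  set η := ε * R ^ α / N with hη
  have hη0 : 0 < η := by positivity
  have hη1 : η ≤ 1 := by
    rw [hη, div_le_one hN0]
    calc ε * R ^ α ≤ ε * (k * N) := by gcongr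
      _ = ε * k * N := by ring
      _ ≤ 1 * N := by gcongr
      _ = N := one_mul N
  have hRq : R ^ (1 + α) = R * R ^ α := by
    rw [Real.rpow_add (by linarith), Real.rpow_one]
  have e1 : dist x y * η = ε * R ^ (1 + α) := by
    rw [hdR, hη, hRq]
    field_simp
  have e2 : n * η ^ (2 * k) = ε ^ (2 * k) * R ^ (1 + α) := by
    rw [hη, div_pow, mul_pow, hNn, ← Real.rpow_natCast (R ^ α), ← Real.rpow_mul hR0, hαq]
    field_simp
  have hb := hmain X π hpos hfin M a hMn hM ha hspec x y n η hn
    (by rw [hdR]; positivity) hη0 hη1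
  rw [hNneg, e1, e2] at hb
  refine hb.trans ?_
  -- The factor `n^(-1/(2k)) = N⁻¹` cancels the `N` in `1 / η`, and `R ≥ 1` removes the rest.
  have h3 : A * N⁻¹ / η ≤ A / ε := by
    have : A * N⁻¹ / η = A / (ε * R ^ α) := by
      rw [hη]
      field_simp
    rw [this]
    gcongr
    exact le_mul_of_one_le_right hε0.le hRα1
  have h4 : K * (ε ^ (2 * k) * R ^ (1 + α)) - ε * R ^ (1 + α) ≤ -(ε / 2 * R ^ (1 + α)) := by
    have : 0 ≤ R ^ (1 + α) := by positivity
    nlinarith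
  calc _ ≤ A / ε * Real.exp (-(ε / 2 * R ^ (1 + α))) * P := by gcongr
    _ = A / ε * P * Real.exp (-(ε / 2 * R ^ (1 + α))) := by ring
    _ ≤ _ := by gcongr; exact le_add_of_nonneg_left (Real.exp_pos _).le

end
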